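/- Let $H$ be a complex Hilbert space, and let $\mathfrak t$ be a sesquilinear form on a linear subspace $\operatorname{dom}\mathfrak t\subset H$ (not necessarily dense), linear in the first entry and antilinear in the second. Write $\mathfrak t[\varphi]=\mathfrak t[\varphi,\varphi]$. Assume that $\mathfrak t$ is semibounded, i.e. for some $c\in\mathbb R$ every $\mathfrak t[\varphi]$ is real and $\mathfrak t[\varphi]\ge c\|\varphi\|^2$, and let $m(\mathfrak t)=\inf\{\mathfrak t[\varphi]/\|\varphi\|^2:0\ne\varphi\in\operatorname{dom}\mathfrak t\}$ be its lower bound (put $m(\mathfrak t)=0$ if $\operatorname{dom}\mathfrak t=\{0\}$). A linear relation from $H$ to a Hilbert space $K$ is a linear subspace $T\subset H\times K$; its adjoint is $T^*=\{\{k,f\}\in K\times H: (f,h)=(k,h')\text{ for all }\{h,h'\}\in T\}$; operators are identified with their graphs. Products are $ST=\{\{f,h\}:\{f,g\}\in T,\ \{g,h\}\in S\text{ for some }g\}$. A relation $T$ in $H$ has the shift $T+c=\{\{f,f'+cf\}:\{f,f'\}\in T\}$; it is symmetric if $T\subset T^*$, selfadjoint if $T=T^*$, and bounded from below by $c$ if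 $(f',f)$ is real and $(f',f)\ge c\|f\|^2$ for all $\{f,f'\}\in T$. For $\varphi_n\in\operatorname{dom}\mathfrak t$ and $\varphi\in H$ write $\varphi_n\to_{\mathfrak t}\varphi$ if $\varphi_n\to\varphi$ in $H$ and $\mathfrak t[\varphi_n-\varphi_m]\to0$ as $n,m\to\infty$. For $c\le m(\mathfrak t)$, a representing map for $\mathfrak t-c$ is a linear operator $Q_c$ from $H$ to a Hilbert space $K$ with $\operatorname{dom}Q_c=\operatorname{dom}\mathfrak t$ and $\mathfrak t[\varphi,\psi]-c(\varphi,\psi)=(Q_c\varphi,Q_c\psi)$ for all $\varphi,\psi\in\operatorname{dom}\mathfrak t$. Then there are linear relations $S_{\mathfrak t}$ and $\widetilde A_{\mathfrak t}$ in $H$ with the following properties. (A) $S_{\mathfrak t}$ is symmetric and bounded from below by $m(\mathfrak t)$, $\operatorname{dom}S_{\mathfrak t}\subset\operatorname{dom}\mathfrak t$, and for each $\{\varphi,\varphi'\}\in S_{\mathfrak t}$ $$\mathfrak t[\varphi,\psi]=(\varphi',\psi)\quad\text{for all }\psi\in\operatorname{dom}\mathfrak t.\qquad(1)$$ If $R$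 is any symmetric relation in $H$ with $\operatorname{dom}R\subset\operatorname{dom}\mathfrak t$ such that (1) holds for each $\{\varphi,\varphi'\}\in R$, then $R\subset S_{\mathfrak t}$. (B) $\widetilde A_{\mathfrak t}$ is a selfadjoint extension of $S_{\mathfrak t}$, bounded from below by $m(\mathfrak t)$, such that for each $\{\varphi,\varphi'\}\in\widetilde A_{\mathfrak t}$ there is a sequence $\varphi_n\in\operatorname{dom}\mathfrak t$ with $$\varphi_n\to_{\mathfrak t}\varphi\quad\text{and}\quad\mathfrak t[\varphi_n,\psi]\to(\varphi',\psi)\quad\text{for all }\psi\in\operatorname{dom}\mathfrak t.\qquad(2)$$ If $R$ is any selfadjoint relation in $H$ such that for each $\{\varphi,\varphi'\}\in R$ there is a sequence $\varphi_n\in\operatorname{dom}\mathfrak t$ satisfying (2), then $R=\widetilde A_{\mathfrak t}$. (C) For every $c\le m(\mathfrak t)$ the form $\mathfrak t-c$ has a representing map, and for every representing map $Q_c$ for $\mathfrak t-c$, into any Hilbert space, $$S_{\mathfrak t}=Q_c^*Q_c+c\quad\text{and}\quad\widetilde A_{\mathfrak t}=Q_c^*Q_c^{**}+c.$$ In particular,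 $S_{\mathfrak t}$ and $\widetilde A_{\mathfrak t}$ do not depend on the choice of $c\le m(\mathfrak t)$ and of $Q_c$. -/

import Mathlib

open Filter Topology

universe u v w

/-! ### Linear relations

A linear relation from `E` to `F` is a linear subspace of `E × F`; its adjoint is Mathlib's
`Submodule.adjoint`, and a linear operator is identified with its graph. -/

namespace LinRel

section

variable {E : Type u} {F : Type v} {G : Type w}
  [NormedAddCommGroup E] [InnerProductSpace ℂ E]
  [NormedAddCommGroup F] [InnerProductSpace ℂ F]
  [NormedAddCommGroup G] [InnerProductSpace ℂ G]

/-- The domain of a linear relation. -/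
def dom (T : Submodule ℂ (E × F)) : Submodule ℂ E :=
  T.map (LinearMap.fst ℂ E F)

/-- The product `S T = {{f, h} : {f, g} ∈ T, {g, h} ∈ S for some g}` of linear relations. -/
def comp (S : Submodule ℂ (F × G)) (T : Submodule ℂ (E × F)) : Submodule ℂ (E × G) where
  carrier := {p | ∃ g : F, (p.1, g) ∈ T ∧ (g, p.2) ∈ S}
  zero_mem' := ⟨0, T.zero_mem, S.zero_mem⟩
  add_mem' := by
    rintro p q ⟨g, hg, hg'⟩ ⟨k, hk, hk'⟩
    exact ⟨g + k, T.add_mem hg hk, S.add_mem hg' hk'⟩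
  smul_mem' := by
    rintro a p ⟨g, hg, hg'⟩
    exact ⟨a • g, T.smul_mem a hg, S.smul_mem a hg'⟩

/-- The shift `T + c = {{f, f' + c f} : {f, f'} ∈ T}` of a linear relation in a space. -/
def addScalar (T : Submodule ℂ (E × E)) (c : ℝ) : Submodule ℂ (E × E) :=
  T.map ((LinearMap.fst ℂ E E).prod
    (LinearMap.snd ℂ E E + (c : ℂ) • LinearMap.fst ℂ E E))

/-- `T` is symmetric: `T ⊂ T*`. -/
def IsSymmetric (T : Submodule ℂ (E × E)) : Prop := T ≤ T.adjoint

/-- `T` is selfadjoint: `T = T*`. -/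
def IsSelfAdjoint (T : Submodule ℂ (E × E)) : Prop := T = T.adjoint

/-- `T` is bounded from below by `c`: for every `{f, f'} ∈ T` the number `(f', f)` is real and at
least `c ‖f‖²`. -/
def BoundedBelowBy (T : Submodule ℂ (E × E)) (c : ℝ) : Prop :=
  ∀ f f' : E, (f, f') ∈ T → (inner ℂ f f').im = 0 ∧ c * ‖f‖ ^ 2 ≤ (inner ℂ f f').re

end

end LinRel

/-- A sesquilinear form in `H`, defined on a linear subspace of `H`, linear in the first and
antilinear in the second entry. -/
structure SesqForm (H : Type u) [NormedAddCommGroup H] [InnerProductSpace ℂ H] where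
  /-- the domain of the form -/
  dom : Submodule ℂ H
  /-- the values of the form -/
  form : dom →ₗ[ℂ] dom →ₗ⋆[ℂ] ℂ

namespace SesqForm

section

variable {H : Type u} [NormedAddCommGroup H] [InnerProductSpace ℂ H]

/-- `t` is bounded from below by `c`: every `t[φ]` is real and at least `c ‖φ‖²`. -/
def BoundedBelowBy (t : SesqForm H) (c : ℝ) : Prop :=
  ∀ φ : t.dom, (t.form φ φ).im = 0 ∧ c * ‖(φ : H)‖ ^ 2 ≤ (t.form φ φ).re

/-- `t` is semibounded: it is bounded from below by some real number. -/
def IsSemibounded (t : SesqForm H) : Prop := ∃ c : ℝ, t.BoundedBelowBy c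

/-- The lower bound `m(t)`, the infimum of the quotients `t[φ] / ‖φ‖²` over the nonzero `φ` in the
domain of `t`. -/
noncomputable def lowerBound (t : SesqForm H) : ℝ :=
  sInf {r : ℝ | ∃ φ : t.dom, φ ≠ 0 ∧ r = (t.form φ φ).re / ‖(φ : H)‖ ^ 2}

/-- The form `t - c`, given by `(t - c)[φ, ψ] = t[φ, ψ] - c (φ, ψ)` on the domain of `t`. The inner
product of Mathlib is linear in the second entry, so that `(φ, ψ)` is `inner ℂ ψ φ`. -/
noncomputable def subScalar (t : SesqForm H) (c : ℝ) : SesqForm H where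
  dom := t.dom
  form := LinearMap.mk₂'ₛₗ (RingHom.id ℂ) (starRingEnd ℂ)
    (fun φ ψ => t.form φ ψ - (c : ℂ) * inner ℂ (ψ : H) (φ : H))
    (by intro a b d; simp; ring)
    (by intro k a b; simp; ring)
    (by intro a b d; simp; ring)
    (by intro k a b; simp; ring)

/-- `φₙ →_t φ`: the sequence `φₙ` in the domain of `t` converges to `φ` in `H`, and
`t[φₙ - φₘ] → 0` as `n, m → ∞`. -/
def ConvergesTo (t : SesqForm H) (φs : ℕ → t.dom) (φ : H) : Prop :=
  Tendsto (fun n => (φs n : H)) atTop (𝓝 φ) ∧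
    Tendsto (fun p : ℕ × ℕ => t.form (φs p.1 - φs p.2) (φs p.1 - φs p.2)) atTop (𝓝 0)

/-- For each `{φ, φ'} ∈ S` with `φ` in the domain of `t` one has `t[φ, ψ] = (φ', ψ)` for all `ψ` in
the domain of `t`. -/
def Represents (t : SesqForm H) (S : Submodule ℂ (H × H)) : Prop :=
  ∀ (φ : t.dom) (φ' : H), ((φ : H), φ') ∈ S →
    ∀ ψ : t.dom, t.form φ ψ = inner ℂ (ψ : H) φ'

/-- For each `{φ, φ'} ∈ A` there is a sequence `φₙ` in the domain of `t` with `φₙ →_t φ` and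
`t[φₙ, ψ] → (φ', ψ)` for all `ψ` in the domain of `t`. -/
def LimitRepresents (t : SesqForm H) (A : Submodule ℂ (H × H)) : Prop :=
  ∀ φ φ' : H, (φ, φ') ∈ A → ∃ φs : ℕ → t.dom, t.ConvergesTo φs φ ∧
    ∀ ψ : t.dom, Tendsto (fun n => t.form (φs n) ψ) atTop (𝓝 (inner ℂ (ψ : H) φ'))

/-- `Q` is a representing map for the (nonnegative) form `s`: a linear operator from `H` to `K`,
with the domain of `s` as its domain, such that `s[φ, ψ] = (Q φ, Q ψ)`. -/
structure IsRepresentingMap (s : SesqForm H) {K : Type v} [NormedAddCommGroup K]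
    [InnerProductSpace ℂ K] (Q : H →ₗ.[ℂ] K) : Prop where
  dom_eq : s.dom = Q.domain
  form_eq : ∀ φ ψ : s.dom,
    s.form φ ψ = inner ℂ (Q ⟨ψ, dom_eq ▸ ψ.2⟩) (Q ⟨φ, dom_eq ▸ φ.2⟩)

end

end SesqForm

/-!
Both relations have descriptions that mention neither `c` nor a representing map. For a representing
map `Q` of `t - c`, the relation `Q* Q + c` consists of the pairs `{φ, φ'}` with `φ ∈ dom t` and
`t[φ, ψ] = (φ', ψ)` on `dom t`
(`SesqForm.IsRepresentingMap.mem_addScalar_comp_graph_iff`), and `Q* Q** + c` consists of the pairs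
that are limits as required of `A`
(`SesqForm.IsRepresentingMap.mem_addScalar_comp_adjoint_adjoint_iff`). The second description holds
because `Q**` is the closure of the graph of `Q`, and because `φₙ →_t φ` means that `φₙ → φ` and that
`Q φₙ` is a Cauchy sequence, convergent in the Hilbert space `K`. Hence neither relation depends on
`c` or `Q`, and the maximality of `S` and the inclusion `R ≤ A` for the competitors of `A` are
immediate. Since passing to adjoints reverses inclusions, selfadjoint relations that are comparable
are equal, so `R = A` as soon as `A` is selfadjoint.

The selfadjointness of `A` is von Neumann's theorem for `T = Q**`
(`LinRel.isSelfAdjoint_comp_adjoint`): `T* T` is symmetric, and projecting `{z, 0}` orthogonally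
onto the closed relation `T` shows that `T* T + 1` has full range. The lower bound comes from the
choice `c = m(t)`. Representing maps exist, because the nonnegative form `t - c` is the pullback of
the inner product of a Hilbert space, obtained by separation and completion.
-/

/-! ### Linear relations between Hilbert spaces -/

namespace LinRel

section

variable {E : Type u} {F : Type v} {G : Type w}
  [NormedAddCommGroup E] [InnerProductSpace ℂ E]
  [NormedAddCommGroup F] [InnerProductSpace ℂ F]
  [NormedAddCommGroup G] [InnerProductSpace ℂ G]

theorem mem_dom {T : Submodule ℂ (E × F)} {x : E} : x ∈ dom T ↔ ∃ y, (x, y) ∈ T := by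
  simp [dom]

theorem mem_comp {S : Submodule ℂ (F × G)} {T : Submodule ℂ (E × F)} {x : E} {z : G} :
    (x, z) ∈ comp S T ↔ ∃ y, (x, y) ∈ T ∧ (y, z) ∈ S := Iff.rfl

theorem mem_addScalar {T : Submodule ℂ (E × E)} {c : ℝ} {x y : E} :
    (x, y) ∈ addScalar T c ↔ (x, y - (c : ℂ) • x) ∈ T := by
  constructor
  · rintro ⟨⟨a, b⟩, h, hab⟩
    obtain ⟨rfl, rfl⟩ : a = x ∧ b + (c : ℂ) • a = y := Prod.mk.inj hab
    rwa [add_sub_cancel_right]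
  · exact fun h => ⟨_, h, Prod.ext rfl (sub_add_cancel y _)⟩

theorem mem_adjoint {T : Submodule ℂ (E × F)} {y : F} {x : E} :
    (y, x) ∈ T.adjoint ↔ ∀ a b, (a, b) ∈ T → inner ℂ b y = inner ℂ a x := by
  simp [Submodule.mem_adjoint_iff, sub_eq_zero]

theorem inner_eq_of_mem_adjoint {T : Submodule ℂ (E × F)} {a x : E} {b y : F}
    (h : (y, x) ∈ T.adjoint) (hab : (a, b) ∈ T) : inner ℂ y b = inner ℂ x a := by
  rw [← inner_conj_symm, mem_adjoint.1 h a b hab, inner_conj_symm]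

theorem adjoint_anti {S T : Submodule ℂ (E × F)} (h : S ≤ T) : T.adjoint ≤ S.adjoint := by
  rintro ⟨y, x⟩ hyx
  exact mem_adjoint.2 fun a b hab => mem_adjoint.1 hyx a b (h hab)

theorem le_adjoint_adjoint (T : Submodule ℂ (E × F)) : T ≤ T.adjoint.adjoint := by
  rintro ⟨x, y⟩ hxy
  exact mem_adjoint.2 fun b a hba => (inner_eq_of_mem_adjoint hba hxy).symm

theorem adjoint_adjoint_adjoint (T : Submodule ℂ (E × F)) :
    T.adjoint.adjoint.adjoint = T.adjoint :=
  le_antisymm (adjoint_anti (le_adjoint_adjoint T)) (le_adjoint_adjoint T.adjoint)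

theorem isClosed_adjoint (T : Submodule ℂ (E × F)) : IsClosed (T.adjoint : Set (F × E)) := by
  have : (T.adjoint : Set (F × E)) =
      ⋂ (a : E) (b : F) (_ : (a, b) ∈ T), {p : F × E | inner ℂ b p.1 = inner ℂ a p.2} := by
    ext ⟨y, x⟩
    simp only [SetLike.mem_coe, mem_adjoint, Set.mem_iInter, Set.mem_ofPred_eq]
  rw [this]
  exact isClosed_iInter fun a => isClosed_iInter fun b => isClosed_iInter fun _ =>
    isClosed_eq (by fun_prop) (by fun_prop)

/-- The orthogonal decomposition of `E × F` along a closed relation `T`: the orthogonal complement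
of `T` is the adjoint of `T` with its components swapped and one sign changed. -/
theorem exists_mem_of_isClosed [CompleteSpace E] [CompleteSpace F] {T : Submodule ℂ (E × F)}
    (hT : IsClosed (T : Set (E × F))) (x : E) (y : F) :
    ∃ g k, (g, k) ∈ T ∧ (k - y, x - g) ∈ T.adjoint := by
  -- the Hilbert space structure of the product is that of `WithLp 2 (E × F)`
  let U : Submodule ℂ (WithLp 2 (E × F)) :=
    T.comap (WithLp.linearEquiv 2 ℂ (E × F)).toLinearMap
  have hU : IsClosed (U : Set (WithLp 2 (E × F))) :=
    hT.preimage (WithLp.prod_continuous_ofLp 2 E F)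
  have : CompleteSpace U := hU.completeSpace_coe
  obtain ⟨p, hp, q, hq, hpq⟩ := U.exists_add_mem_mem_orthogonal (WithLp.toLp 2 (x, y))
  have h1 : x = p.fst + q.fst := congrArg WithLp.fst hpq
  have h2 : y = p.snd + q.snd := congrArg WithLp.snd hpq
  refine ⟨p.fst, p.snd, hp, mem_adjoint.2 fun a b hab => ?_⟩
  have h := (U.mem_orthogonal q).1 hq (WithLp.toLp 2 (a, b)) hab
  rw [WithLp.prod_inner_apply] at h
  rw [h1, h2, add_sub_cancel_left, sub_add_cancel_left, inner_neg_right]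
  exact (eq_neg_of_add_eq_zero_left h).symm

theorem adjoint_adjoint_eq_topologicalClosure [CompleteSpace E] [CompleteSpace F]
    (T : Submodule ℂ (E × F)) : T.adjoint.adjoint = T.topologicalClosure := by
  have hle : T.topologicalClosure ≤ T.adjoint.adjoint :=
    T.topologicalClosure_minimal (le_adjoint_adjoint T) (isClosed_adjoint _)
  refine le_antisymm ?_ hle
  rintro ⟨x, y⟩ hxy
  obtain ⟨g, k, hgk, h⟩ := exists_mem_of_isClosed T.isClosed_topologicalClosure x y
  -- `{x - g, y - k}` lies in `T**` and is orthogonal to it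
  have h0 := mem_adjoint.1 (sub_mem hxy (hle hgk)) _ _ (adjoint_anti T.le_topologicalClosure h)
  have h1 : inner ℂ (x - g) (x - g) = inner ℂ (k - y) (y - k) := h0
  rw [← neg_sub y k, inner_neg_left, inner_self_eq_norm_sq_to_K, inner_self_eq_norm_sq_to_K] at h1
  have h2 : ‖x - g‖ ^ 2 = -‖y - k‖ ^ 2 := by exact_mod_cast h1
  have hx : x - g = 0 := norm_eq_zero.1 (pow_eq_zero_iff two_ne_zero |>.1
    (by nlinarith [sq_nonneg ‖x - g‖, sq_nonneg ‖y - k‖]))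
  have hy : y - k = 0 := norm_eq_zero.1 (pow_eq_zero_iff two_ne_zero |>.1
    (by nlinarith [sq_nonneg ‖x - g‖, sq_nonneg ‖y - k‖]))
  rwa [sub_eq_zero.1 hx, sub_eq_zero.1 hy]

theorem isSelfAdjoint_of_le {S T : Submodule ℂ (E × E)} (hS : IsSelfAdjoint S)
    (hT : IsSelfAdjoint T) (h : S ≤ T) : S = T :=
  le_antisymm h (by rw [IsSelfAdjoint] at hS hT; rw [hS, hT]; exact adjoint_anti h)

/-- A symmetric relation `T` with `ran (T + 1)` the whole space is selfadjoint. -/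
theorem IsSymmetric.isSelfAdjoint_of_range {T : Submodule ℂ (E × E)} (hT : IsSymmetric T)
    (h : ∀ z : E, ∃ x y, (x, y) ∈ T ∧ x + y = z) : IsSelfAdjoint T := by
  refine le_antisymm hT ?_
  rintro ⟨k, f⟩ hkf
  obtain ⟨b, b', hb, hbz⟩ := h (k + f)
  obtain ⟨a, a', ha, haz⟩ := h (k - b)
  -- `{k - b, f - b'} ∈ T*` and `f - b' = -(k - b)`, so that `k - b` is orthogonal to `ran (T + 1)`
  have h1 : inner ℂ a' (k - b) = inner ℂ a (f - b') :=
    mem_adjoint.1 (sub_mem hkf (hT hb)) a a' ha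
  have h2 : f - b' = -(k - b) := by
    rw [neg_sub, sub_eq_sub_iff_add_eq_add, add_comm f k, hbz]
  have h3 : inner ℂ (k - b) (k - b) = 0 := by
    nth_rewrite 1 [← haz]
    rw [inner_add_left, h1, h2, inner_neg_right, add_neg_cancel]
  have h4 : k - b = 0 := inner_self_eq_zero.1 h3
  rw [h4, neg_zero] at h2
  rwa [sub_eq_zero.1 h4, sub_eq_zero.1 h2]

theorem isSymmetric_comp_adjoint (T : Submodule ℂ (E × F)) : IsSymmetric (comp T.adjoint T) := by
  rintro ⟨x, x'⟩ ⟨y, hxy, hyx⟩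
  refine mem_adjoint.2 ?_
  rintro a a' ⟨b, hab, hba⟩
  exact (inner_eq_of_mem_adjoint hba hxy).symm.trans (mem_adjoint.1 hyx a b hab)

/-- Von Neumann's theorem for relations: `T* T` is selfadjoint if `T` is closed. -/
theorem isSelfAdjoint_comp_adjoint [CompleteSpace E] [CompleteSpace F] {T : Submodule ℂ (E × F)}
    (hT : IsClosed (T : Set (E × F))) : IsSelfAdjoint (comp T.adjoint T) := by
  refine (isSymmetric_comp_adjoint T).isSelfAdjoint_of_range fun z => ?_
  -- the component of `{z, 0}` in `T` solves `z ∈ (T* T + 1) g`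
  obtain ⟨g, k, hgk, h⟩ := exists_mem_of_isClosed hT z 0
  rw [sub_zero] at h
  exact ⟨g, z - g, ⟨k, hgk, h⟩, add_sub_cancel g z⟩

theorem adjoint_addScalar (T : Submodule ℂ (E × E)) (c : ℝ) :
    (addScalar T c).adjoint = addScalar T.adjoint c := by
  ext ⟨y, x⟩
  rw [mem_addScalar, mem_adjoint, mem_adjoint]
  have key : ∀ a b : E, inner ℂ (b - (c : ℂ) • a) y = inner ℂ a (x - (c : ℂ) • y) ↔
      inner ℂ b y = inner ℂ a x := by
    intro a b
    rw [inner_sub_left, inner_sub_right, inner_smul_left, inner_smul_right, Complex.conj_ofReal,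
      sub_left_inj]
  constructor
  · intro h a b hab
    have := h a (b + (c : ℂ) • a) (mem_addScalar.2 (by simpa using hab))
    rw [← key, add_sub_cancel_right] at this
    exact this
  · intro h a b hab
    exact (key a b).1 (h a _ (mem_addScalar.1 hab))

theorem IsSelfAdjoint.addScalar {T : Submodule ℂ (E × E)} (hT : IsSelfAdjoint T) (c : ℝ) :
    IsSelfAdjoint (addScalar T c) := by
  rw [IsSelfAdjoint, adjoint_addScalar, ← hT]

theorem boundedBelowBy_addScalar_comp_adjoint (T : Submodule ℂ (E × F)) (c : ℝ) :
    BoundedBelowBy (addScalar (comp T.adjoint T) c) c := by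
  intro f f' hf
  obtain ⟨k, hfk, hkf⟩ := mem_comp.1 (mem_addScalar.1 hf)
  have h := mem_adjoint.1 hkf f k hfk
  rw [inner_sub_right, inner_smul_right, inner_self_eq_norm_sq_to_K, inner_self_eq_norm_sq_to_K,
    eq_sub_iff_add_eq] at h
  have h' : inner ℂ f f' = ((‖k‖ ^ 2 + c * ‖f‖ ^ 2 : ℝ) : ℂ) := by
    rw [← h]; push_cast; rfl
  rw [h', Complex.ofReal_im, Complex.ofReal_re]
  exact ⟨rfl, le_add_of_nonneg_left (sq_nonneg _)⟩

end

end LinRel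

/-! ### Hilbert spaces from nonnegative forms -/

/-- Every nonnegative Hermitian form on a vector space is the pullback of the inner product of some
Hilbert space, the completion of the quotient by the vectors of length zero. -/
theorem PreInnerProductSpace.Core.exists_linearMap_inner_eq {V : Type u} [AddCommGroup V]
    [Module ℂ V] (C : PreInnerProductSpace.Core ℂ V) :
    ∃ (K : Type u) (_ : NormedAddCommGroup K) (_ : InnerProductSpace ℂ K) (_ : CompleteSpace K)
      (f : V →ₗ[ℂ] K), ∀ x y, inner ℂ (f x) (f y) = C.inner x y := by
  let _ : SeminormedAddCommGroup V := InnerProductSpace.Core.toSeminormedAddCommGroup (c := C)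
  let _ : InnerProductSpace ℂ V := InnerProductSpace.ofCore C
  refine ⟨UniformSpace.Completion (SeparationQuotient V), inferInstance, inferInstance,
    inferInstance, (UniformSpace.Completion.toComplL (𝕜 := ℂ)
      (E := SeparationQuotient V)).toLinearMap ∘ₗ
      (SeparationQuotient.mkCLM ℂ V).toLinearMap, fun x y => ?_⟩
  exact (UniformSpace.Completion.inner_coe _ _).trans (SeparationQuotient.inner_mk_mk x y)

/-! ### Semibounded forms and their representing maps -/

namespace SesqForm

section

variable {H : Type u} [NormedAddCommGroup H] [InnerProductSpace ℂ H]

theorem subScalar_form (t : SesqForm H) (c : ℝ) (φ ψ : t.dom) :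
    (t.subScalar c).form φ ψ = t.form φ ψ - (c : ℂ) * inner ℂ (ψ : H) (φ : H) := rfl

theorem IsSemibounded.boundedBelowBy_of_le_lowerBound {t : SesqForm H} (ht : t.IsSemibounded)
    {c : ℝ} (hc : c ≤ t.lowerBound) : t.BoundedBelowBy c := by
  obtain ⟨d, hd⟩ := ht
  intro φ
  refine ⟨(hd φ).1, ?_⟩
  by_cases hφ : φ = 0
  · simp [hφ]
  have hpos : 0 < ‖(φ : H)‖ ^ 2 := by
    have : (φ : H) ≠ 0 := fun h => hφ (Subtype.ext h)
    positivity
  rw [← le_div_iff₀ hpos]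
  refine hc.trans (csInf_le ⟨d, ?_⟩ ⟨φ, hφ, rfl⟩)
  rintro r ⟨ψ, hψ, rfl⟩
  have hpos' : 0 < ‖(ψ : H)‖ ^ 2 := by
    have : (ψ : H) ≠ 0 := fun h => hψ (Subtype.ext h)
    positivity
  exact (le_div_iff₀ hpos').2 (hd ψ).2

/-- A form with real diagonal values is Hermitian, by polarization. -/
theorem conj_form_eq {s : SesqForm H} (hs : ∀ φ, (s.form φ φ).im = 0) (φ ψ : s.dom) :
    (starRingEnd ℂ) (s.form φ ψ) = s.form ψ φ := by
  have h1 := hs (φ + ψ)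
  have h2 := hs (φ + Complex.I • ψ)
  have hφ := hs φ
  have hψ := hs ψ
  simp only [map_add, LinearMap.add_apply, LinearMap.map_smulₛₗ, LinearMap.smul_apply,
    RingHom.id_apply, smul_eq_mul, Complex.conj_I, Complex.add_re, Complex.add_im, Complex.mul_im, Complex.mul_re,
    Complex.neg_re, Complex.neg_im, Complex.I_re, Complex.I_im] at h1 h2
  apply Complex.ext
  · rw [Complex.conj_re]; linarith
  · rw [Complex.conj_im]; linarith

theorem BoundedBelowBy.exists_isRepresentingMap {t : SesqForm H} {c : ℝ}
    (ht : t.BoundedBelowBy c) :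
    ∃ (K : Type u) (_ : NormedAddCommGroup K) (_ : InnerProductSpace ℂ K) (_ : CompleteSpace K)
      (Q : H →ₗ.[ℂ] K), (t.subScalar c).IsRepresentingMap Q := by
  have hdiag (φ : t.dom) : (t.subScalar c).form φ φ =
      t.form φ φ - ((c * ‖(φ : H)‖ ^ 2 : ℝ) : ℂ) := by
    rw [subScalar_form, inner_self_eq_norm_sq_to_K]
    push_cast
    rfl
  have him : ∀ φ : t.dom, ((t.subScalar c).form φ φ).im = 0 := fun φ => by
    rw [hdiag, Complex.sub_im, Complex.ofReal_im, sub_zero]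
    exact (ht φ).1
  let C : PreInnerProductSpace.Core ℂ t.dom :=
    { inner := fun x y => (t.subScalar c).form y x
      conj_inner_symm := fun x y => conj_form_eq (s := t.subScalar c) him x y
      re_inner_nonneg := fun x => by
        change 0 ≤ ((t.subScalar c).form x x).re
        rw [hdiag, Complex.sub_re, Complex.ofReal_re]
        exact sub_nonneg.2 (ht x).2
      add_left := fun x y z => map_add ((t.subScalar c).form z) x y
      smul_left := fun x y r => LinearMap.map_smulₛₗ ((t.subScalar c).form y) r x }
  obtain ⟨K, _, _, _, f, hf⟩ := C.exists_linearMap_inner_eq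
  exact ⟨K, inferInstance, inferInstance, inferInstance, ⟨t.dom, f⟩, rfl, fun φ ψ =>
    (hf ψ φ).symm⟩

variable {K : Type v} [NormedAddCommGroup K] [InnerProductSpace ℂ K]

namespace IsRepresentingMap

variable {t : SesqForm H} {c : ℝ} {Q : H →ₗ.[ℂ] K}

/-- The representing map as a linear map on the domain of the form. -/
def toLinearMap (hQ : (t.subScalar c).IsRepresentingMap Q) : t.dom →ₗ[ℂ] K :=
  Q.toFun ∘ₗ (LinearEquiv.ofEq t.dom Q.domain hQ.dom_eq).toLinearMap

theorem mem_graph_iff (hQ : (t.subScalar c).IsRepresentingMap Q) {x : H} {k : K} :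
    (x, k) ∈ Q.graph ↔ ∃ φ : t.dom, (φ : H) = x ∧ hQ.toLinearMap φ = k := by
  rw [LinearPMap.mem_graph_iff]
  constructor
  · rintro ⟨y, hy, hyk⟩
    exact ⟨⟨y, hQ.dom_eq.symm ▸ y.2⟩, hy, hyk⟩
  · rintro ⟨φ, hφ, hφk⟩
    exact ⟨⟨φ, hQ.dom_eq ▸ φ.2⟩, hφ, hφk⟩

theorem form_eq_inner (hQ : (t.subScalar c).IsRepresentingMap Q) (φ ψ : t.dom) :
    t.form φ ψ = inner ℂ (hQ.toLinearMap ψ) (hQ.toLinearMap φ) +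
      (c : ℂ) * inner ℂ (ψ : H) (φ : H) :=
  sub_eq_iff_eq_add.1 (hQ.form_eq φ ψ)

theorem mem_adjoint_graph_iff (hQ : (t.subScalar c).IsRepresentingMap Q) {k : K} {f : H} :
    (k, f) ∈ Q.graph.adjoint ↔ ∀ ψ : t.dom, inner ℂ (hQ.toLinearMap ψ) k = inner ℂ (ψ : H) f := by
  rw [LinRel.mem_adjoint]
  constructor
  · exact fun h ψ => h _ _ (hQ.mem_graph_iff.2 ⟨ψ, rfl, rfl⟩)
  · intro h a b hab
    obtain ⟨ψ, rfl, rfl⟩ := hQ.mem_graph_iff.1 hab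
    exact h ψ

theorem mem_addScalar_comp_graph_iff (hQ : (t.subScalar c).IsRepresentingMap Q) {x x' : H} :
    (x, x') ∈ LinRel.addScalar (LinRel.comp Q.graph.adjoint Q.graph) c ↔
      ∃ φ : t.dom, (φ : H) = x ∧ ∀ ψ : t.dom, t.form φ ψ = inner ℂ (ψ : H) x' := by
  have key : ∀ φ ψ : t.dom, inner ℂ (hQ.toLinearMap ψ) (hQ.toLinearMap φ) =
      inner ℂ (ψ : H) (x' - (c : ℂ) • (φ : H)) ↔ t.form φ ψ = inner ℂ (ψ : H) x' := by
    intro φ ψ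
    rw [hQ.form_eq_inner, inner_sub_right, inner_smul_right, eq_sub_iff_add_eq]
  rw [LinRel.mem_addScalar, LinRel.mem_comp]
  constructor
  · rintro ⟨k, hk, hk'⟩
    obtain ⟨φ, rfl, rfl⟩ := hQ.mem_graph_iff.1 hk
    exact ⟨φ, rfl, fun ψ => (key φ ψ).1 (hQ.mem_adjoint_graph_iff.1 hk' ψ)⟩
  · rintro ⟨φ, rfl, h⟩
    exact ⟨_, hQ.mem_graph_iff.2 ⟨φ, rfl, rfl⟩,
      hQ.mem_adjoint_graph_iff.2 fun ψ => (key φ ψ).2 (h ψ)⟩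

/-- Convergence with respect to the form is convergence in the graph of a representing map. -/
theorem convergesTo_iff [CompleteSpace K] (hQ : (t.subScalar c).IsRepresentingMap Q)
    {φs : ℕ → t.dom} {x : H} :
    t.ConvergesTo φs x ↔ Tendsto (fun n => (φs n : H)) atTop (𝓝 x) ∧
      ∃ k, Tendsto (fun n => hQ.toLinearMap (φs n)) atTop (𝓝 k) := by
  refine and_congr_right fun hx => ?_
  have hsub : Tendsto (fun p : ℕ × ℕ => (φs p.1 : H) - φs p.2) atTop (𝓝 0) := by
    rw [← prod_atTop_atTop_eq, ← sub_self x]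
    exact (hx.comp tendsto_fst).sub (hx.comp tendsto_snd)
  have hc : Tendsto (fun p : ℕ × ℕ => (c : ℂ) * inner ℂ ((φs p.1 : H) - φs p.2)
      ((φs p.1 : H) - φs p.2)) atTop (𝓝 0) := by
    simpa using (hsub.inner hsub (𝕜 := ℂ)).const_mul (c : ℂ)
  have hform : ∀ p : ℕ × ℕ, t.form (φs p.1 - φs p.2) (φs p.1 - φs p.2) =
      ((‖hQ.toLinearMap (φs p.1) - hQ.toLinearMap (φs p.2)‖ ^ 2 : ℝ) : ℂ) +
      (c : ℂ) * inner ℂ ((φs p.1 : H) - φs p.2) ((φs p.1 : H) - φs p.2) := by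
    intro p
    rw [hQ.form_eq_inner, map_sub, inner_self_eq_norm_sq_to_K]
    push_cast
    rfl
  have hcauchy : Tendsto (fun p : ℕ × ℕ =>
      ‖hQ.toLinearMap (φs p.1) - hQ.toLinearMap (φs p.2)‖) atTop (𝓝 0) ↔
      Tendsto (fun p : ℕ × ℕ => t.form (φs p.1 - φs p.2) (φs p.1 - φs p.2)) atTop (𝓝 0) := by
    simp only [hform]
    constructor
    · intro h
      have h2 := (Complex.continuous_ofReal.tendsto _).comp (h.pow 2)
      simpa [Function.comp_def] using h2.add hc
    · intro h
      have h2 := (Complex.continuous_re.tendsto _).comp (h.sub hc)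
      have h3 := (Real.continuous_sqrt.tendsto _).comp h2
      simpa [Function.comp_def, -Complex.ofReal_pow] using h3
  rw [← hcauchy]
  constructor
  · intro h
    refine cauchySeq_tendsto_of_complete (cauchySeq_iff_tendsto_dist_atTop_0.2 ?_)
    simpa only [dist_eq_norm] using h
  · rintro ⟨k, hk⟩
    simpa only [dist_eq_norm] using cauchySeq_iff_tendsto_dist_atTop_0.1 hk.cauchySeq

theorem mem_addScalar_comp_adjoint_adjoint_iff [CompleteSpace H] [CompleteSpace K]
    (hQ : (t.subScalar c).IsRepresentingMap Q) {x x' : H} :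
    (x, x') ∈ LinRel.addScalar (LinRel.comp Q.graph.adjoint Q.graph.adjoint.adjoint) c ↔
      ∃ φs : ℕ → t.dom, t.ConvergesTo φs x ∧
        ∀ ψ : t.dom, Tendsto (fun n => t.form (φs n) ψ) atTop (𝓝 (inner ℂ (ψ : H) x')) := by
  have hlim : ∀ (φs : ℕ → t.dom) (k : K), Tendsto (fun n => (φs n : H)) atTop (𝓝 x) →
      Tendsto (fun n => hQ.toLinearMap (φs n)) atTop (𝓝 k) → ∀ ψ : t.dom,
      Tendsto (fun n => t.form (φs n) ψ) atTop
        (𝓝 (inner ℂ (hQ.toLinearMap ψ) k + (c : ℂ) * inner ℂ (ψ : H) x)) := by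
    intro φs k hx hk ψ
    simp only [hQ.form_eq_inner]
    exact (tendsto_const_nhds.inner hk).add ((tendsto_const_nhds.inner hx).const_mul _)
  have key : ∀ (k : K) (ψ : t.dom),
      inner ℂ (hQ.toLinearMap ψ) k = inner ℂ (ψ : H) (x' - (c : ℂ) • x) ↔
      inner ℂ (hQ.toLinearMap ψ) k + (c : ℂ) * inner ℂ (ψ : H) x = inner ℂ (ψ : H) x' := by
    intro k ψ
    rw [inner_sub_right, inner_smul_right, eq_sub_iff_add_eq]
  rw [LinRel.mem_addScalar, LinRel.mem_comp, LinRel.adjoint_adjoint_eq_topologicalClosure]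
  constructor
  · rintro ⟨k, hk, hk'⟩
    rw [← SetLike.mem_coe, Submodule.topologicalClosure_coe, mem_closure_iff_seq_limit] at hk
    obtain ⟨p, hp, hpk⟩ := hk
    choose φs hφ hφQ using fun n => hQ.mem_graph_iff.1 (hp n)
    have hx : Tendsto (fun n => (φs n : H)) atTop (𝓝 x) := by
      simpa only [hφ] using hpk.fst_nhds
    have hQk : Tendsto (fun n => hQ.toLinearMap (φs n)) atTop (𝓝 k) := by
      simpa only [hφQ] using hpk.snd_nhds
    refine ⟨φs, hQ.convergesTo_iff.2 ⟨hx, k, hQk⟩, fun ψ => ?_⟩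
    rw [← (key k ψ).1 (hQ.mem_adjoint_graph_iff.1 hk' ψ)]
    exact hlim φs k hx hQk ψ
  · rintro ⟨φs, hφ, hform⟩
    obtain ⟨hx, k, hk⟩ := hQ.convergesTo_iff.1 hφ
    refine ⟨k, ?_, hQ.mem_adjoint_graph_iff.2 fun ψ =>
      (key k ψ).2 (tendsto_nhds_unique (hlim φs k hx hk ψ) (hform ψ))⟩
    exact mem_closure_of_tendsto (hx.prodMk_nhds hk)
      (Eventually.of_forall fun n => hQ.mem_graph_iff.2 ⟨φs n, rfl, rfl⟩)

end IsRepresentingMap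

end

end SesqForm

/-! ### The relations associated with a semibounded form -/

theorem mainTheorem6 {H : Type u} [NormedAddCommGroup H] [InnerProductSpace ℂ H] [CompleteSpace H]
    (t : SesqForm H) (ht : t.IsSemibounded) :
    ∃ S A : Submodule ℂ (H × H),
      -- the maximal symmetric relation
      (LinRel.IsSymmetric S ∧
        LinRel.BoundedBelowBy S t.lowerBound ∧
        LinRel.dom S ≤ t.dom ∧
        t.Represents S ∧
        ∀ R : Submodule ℂ (H × H), LinRel.IsSymmetric R → LinRel.dom R ≤ t.dom →
          t.Represents R → R ≤ S) ∧
      -- the unique selfadjoint relation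
      (S ≤ A ∧
        LinRel.IsSelfAdjoint A ∧
        LinRel.BoundedBelowBy A t.lowerBound ∧
        t.LimitRepresents A ∧
        ∀ R : Submodule ℂ (H × H), LinRel.IsSelfAdjoint R → t.LimitRepresents R → R = A) ∧
      -- the representations, for every `c ≤ m(t)` and every representing map for `t - c`
      (∀ c : ℝ, c ≤ t.lowerBound →
        (∃ (K : Type u) (_ : NormedAddCommGroup K) (_ : InnerProductSpace ℂ K)
          (_ : CompleteSpace K) (Q : H →ₗ.[ℂ] K), (t.subScalar c).IsRepresentingMap Q) ∧
        ∀ (K : Type v) [NormedAddCommGroup K] [InnerProductSpace ℂ K] [CompleteSpace K]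
          (Q : H →ₗ.[ℂ] K), (t.subScalar c).IsRepresentingMap Q →
          S = LinRel.addScalar (LinRel.comp Q.graph.adjoint Q.graph) c ∧
          A = LinRel.addScalar (LinRel.comp Q.graph.adjoint Q.graph.adjoint.adjoint) c) := by
  obtain ⟨K₀, _, _, _, Q₀, hQ₀⟩ :=
    (ht.boundedBelowBy_of_le_lowerBound le_rfl).exists_isRepresentingMap
  set S := LinRel.addScalar (LinRel.comp Q₀.graph.adjoint Q₀.graph) t.lowerBound
  set A := LinRel.addScalar (LinRel.comp Q₀.graph.adjoint Q₀.graph.adjoint.adjoint) t.lowerBound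
    with hAdef
  have hS : ∀ {x x' : H}, (x, x') ∈ S ↔ _ := hQ₀.mem_addScalar_comp_graph_iff
  have hA : ∀ {x x' : H}, (x, x') ∈ A ↔ _ := hQ₀.mem_addScalar_comp_adjoint_adjoint_iff
  have hSA : S ≤ A := by
    rintro ⟨x, x'⟩ hx
    obtain ⟨φ, rfl, hφ⟩ := hS.1 hx
    refine hA.2 ⟨fun _ => φ, ⟨tendsto_const_nhds, by simp⟩, fun ψ => ?_⟩
    simp only [hφ ψ]
    exact tendsto_const_nhds
  -- `Q* = Q***`, so that `Q* Q**` is `T* T` for the closed relation `T = Q**`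
  have hAT : A = LinRel.addScalar (LinRel.comp Q₀.graph.adjoint.adjoint.adjoint
      Q₀.graph.adjoint.adjoint) t.lowerBound := by
    rw [hAdef, LinRel.adjoint_adjoint_adjoint]
  have hAself : LinRel.IsSelfAdjoint A := by
    rw [hAT]
    exact (LinRel.isSelfAdjoint_comp_adjoint (LinRel.isClosed_adjoint _)).addScalar _
  have hAbdd : LinRel.BoundedBelowBy A t.lowerBound := by
    rw [hAT]
    exact LinRel.boundedBelowBy_addScalar_comp_adjoint _ _
  refine ⟨S, A, ⟨?_, fun f f' hf => hAbdd f f' (hSA hf), ?_, ?_, ?_⟩,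
    ⟨hSA, hAself, hAbdd, fun x x' hx => hA.1 hx, ?_⟩, fun c hc =>
    ⟨(ht.boundedBelowBy_of_le_lowerBound hc).exists_isRepresentingMap, ?_⟩⟩
  · exact (hSA.trans hAself.le).trans (LinRel.adjoint_anti hSA)
  · intro x hx
    obtain ⟨x', hx'⟩ := LinRel.mem_dom.1 hx
    obtain ⟨φ, rfl, -⟩ := hS.1 hx'
    exact φ.2
  · intro φ φ' hφ
    obtain ⟨χ, hχ, h⟩ := hS.1 hφ
    rwa [Subtype.ext hχ] at h
  · rintro R - hdom hR ⟨x, x'⟩ hx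
    exact hS.2 ⟨⟨x, hdom (LinRel.mem_dom.2 ⟨x', hx⟩)⟩, rfl, hR _ x' hx⟩
  · intro R hRself hR
    exact LinRel.isSelfAdjoint_of_le hRself hAself fun p hp => hA.2 (hR p.1 p.2 hp)
  · intro K _ _ _ Q hQ
    constructor
    · ext ⟨x, x'⟩
      rw [hS, hQ.mem_addScalar_comp_graph_iff]
    · ext ⟨x, x'⟩
      rw [hA, hQ.mem_addScalar_comp_adjoint_adjoint_iff]
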